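/- We use infinite-time Turing machines (ITTMs) in the sense of Hamkins and Lewis with three one-way infinite tapes (input, output, scratch) over the alphabet $\{0,1\}$, a single head scanning the cells with the same index on all three tapes, and finitely many states, among them a halt state and a limit state; the start state is neither of these two. A computation on input $x\in\{0,1\}^{\mathbb N}$ begins in the start state with the head on the leftmost cell, $x$ on the input tape and the other tapes blank (all $0$). At a successor stage the machine, depending on its state and the three scanned bits, overwrites these bits, moves the head one cell left or right (a left move from the leftmost cell leaves it there), and changes state. At a limit ordinal stage every cell takes the limsup of its earlier values, the head is placed on the leftmost cell, and the machine is in the limit state. The machine halts when it first enters the halt state, and its output is the content of the output tape at that stage. A partial function $f:\{0,1\}^{\mathbb N}\rightharpoonup\{0,1\}^{\mathbb N}$ is infinite-time computable if some ITTM, for every $x$, halts on input $x$ if and only if $f(x)$ is defined, and then with output $f(x)$. For $n\in\mathbb N$ let $\widehat n\in\{0,1\}^{\mathbb N}$ consist of $n$ ones followed by zeros, and let $f^*:\mathbb N\rightharpoonup\mathbb N$ be given by $f^*(n)=k$ if $f(\widehat n)=\widehat k$, and undefined if there is no such $k$. Let $BB_\infty\text{-}n$ be the set of all infinite-time computable $f$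 such that $f^*(0)$ is defined and $f$ is computable by an ITTM with at most $n$ non-halting, non-limit states, and for $n\ge 1$ let $$\Sigma_\infty(n)=\max_{f\in BB_\infty\text{-}n} f^*(0)$$ (with $\Sigma_\infty(0)=0$, as $BB_\infty\text{-}0$ is empty). **Theorem 1.** For every infinite-time computable $f$ such that $f^*$ is total, $\Sigma_\infty(n)>f^*(n)$ for all sufficiently large $n\in\mathbb N$. -/

import Mathlib

namespace InfTime

/-- The states of a machine with `n` non-halting, non-limit states. -/
inductive State (n : ℕ) where
  | halt : State n
  | limit : State n
  | work (i : Fin n) : State n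
  deriving DecidableEq, Fintype

/-- The directions of a head move. -/
inductive Move where
  | left : Move
  | right : Move
  deriving DecidableEq

instance : Fintype Move :=
  ⟨{Move.left, Move.right}, by rintro (_ | _) <;> simp⟩

/-- The content of a one-way infinite tape; `true` is the symbol 1 and `false` the symbol 0. -/
abbrev Tape : Type := ℕ → Bool

/-- The names of the three tapes. -/
inductive TapeName where
  | input : TapeName
  | output : TapeName
  | scratch : TapeName
  deriving DecidableEq

instance : Fintype TapeName :=
  ⟨{TapeName.input, TapeName.output, TapeName.scratch}, by rintro (_ | _ | _) <;> simp⟩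

/-- What one instruction does: the next state, the bits written on the three tapes,
and the move of the head. -/
structure Action (n : ℕ) where
  next : State n
  write : TapeName → Bool
  move : Move

/-- A three-tape infinite-time Turing machine with `n` non-halting, non-limit states.
`prog` gives the action for the current state and the three bits under the head (its values at
the halt state are never used). -/
structure Machine (n : ℕ) where
  start : Fin n
  prog : State n → (TapeName → Bool) → Action n

/-- A snapshot of a computation. One head scans the cells with the same index on all tapes. -/
structure Config (n : ℕ) where
  state : State n
  head : ℕ
  tape : TapeName → Tape

/-- The new head position; a move to the left from the leftmost cell leaves the head there. -/
def Move.apply : Move → ℕ → ℕ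
  | Move.left, p => p - 1
  | Move.right, p => p + 1

/-- The initial configuration on input `x`: the output and the scratch tape are blank. -/
def Machine.init {n : ℕ} (M : Machine n) (x : Tape) : Config n where
  state := State.work M.start
  head := 0
  tape
    | TapeName.input => x
    | TapeName.output => fun _ => false
    | TapeName.scratch => fun _ => false

/-- The action chosen in the configuration `c`. -/
def Machine.action {n : ℕ} (M : Machine n) (c : Config n) : Action n :=
  M.prog c.state (fun t => c.tape t c.head)

/-- One successor step. -/
def Machine.step {n : ℕ} (M : Machine n) (c : Config n) : Config n :=
  if c.state = State.halt then c else
    { state := (M.action c).next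
      head := (M.action c).move.apply c.head
      tape := fun t => Function.update (c.tape t) c.head ((M.action c).write t) }

open Classical in
/-- The configuration at the limit stage `o`, given all earlier ones: limit state, head on the
leftmost cell, and every cell holds the limsup of its earlier values, that is, 1 if and only if
it held 1 at cofinally many earlier stages. -/
noncomputable def limitConfig {n : ℕ} (o : Ordinal.{0})
    (hist : ∀ a : Ordinal.{0}, a < o → Config n) : Config n where
  state := State.limit
  head := 0
  tape := fun t i =>
    decide (∀ a, a < o → ∃ b, ∃ hb : b < o, a ≤ b ∧ (hist b hb).tape t i = true)

/-- The configuration of `M` on input `x` at each ordinal stage (of interest only up to the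
first stage in the halt state). -/
noncomputable def Machine.run {n : ℕ} (M : Machine n) (x : Tape) (o : Ordinal.{0}) : Config n :=
  Ordinal.limitRecOn o (M.init x) (fun _ c => M.step c) (fun l _ hist => limitConfig l hist)

/-- `M` on input `x` reaches the halt state, and when it first does so its output tape
contains `y`. -/
def Machine.HaltsWith {n : ℕ} (M : Machine n) (x y : Tape) : Prop :=
  ∃ o : Ordinal.{0}, (∀ a < o, (M.run x a).state ≠ State.halt) ∧
    (M.run x o).state = State.halt ∧ (M.run x o).tape TapeName.output = y

/-- `M` computes the partial function `f` on Cantor space. -/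
def Machine.Computes {n : ℕ} (M : Machine n) (f : Tape →. Tape) : Prop :=
  ∀ x y, y ∈ f x ↔ M.HaltsWith x y

/-- The partial function `f` is infinite-time computable. -/
def ITComputable (f : Tape →. Tape) : Prop :=
  ∃ n, ∃ M : Machine n, M.Computes f

/-- The unary code of `n`: ones on the first `n` cells, zeros on the others. -/
def unary (n : ℕ) : Tape := fun i => decide (i < n)

/-- The partial function on the naturals induced by `f` through unary codes. -/
noncomputable def star (f : Tape →. Tape) : ℕ →. ℕ := fun n =>
  { Dom := ∃ k, unary k ∈ f (unary n)
    get := fun h => Classical.choose h }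

theorem unary_injective : Function.Injective unary := by
  intro a b h
  have h1 := congrFun h a
  have h2 := congrFun h b
  simp [unary] at h1 h2
  omega

/-- The value of `star` does not depend on the choice in its definition. -/
theorem mem_star_iff (f : Tape →. Tape) (n k : ℕ) :
    k ∈ star f n ↔ unary k ∈ f (unary n) := by
  constructor
  · rintro ⟨h, rfl⟩
    exact Classical.choose_spec h
  · intro h
    have hd : ∃ k, unary k ∈ f (unary n) := ⟨k, h⟩
    exact ⟨hd, unary_injective (Part.mem_unique (Classical.choose_spec hd) h)⟩

/-- The computable functions `f` such that `star f 0` is defined and `f` is computable by a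
machine with at most `n` non-halting, non-limit states. -/
def BBinf (n : ℕ) : Set (Tape →. Tape) :=
  {f | ITComputable f ∧ (star f 0).Dom ∧ ∃ m ≤ n, ∃ M : Machine m, M.Computes f}

/-- The values `star f 0` for `f` in `BBinf n`. -/
def bbValues (n : ℕ) : Set ℕ := {k | ∃ f ∈ BBinf n, k ∈ star f 0}

/-- The infinitary busy beaver function; for `n ≥ 1` the supremum is a maximum, see
`isGreatest_sigmaInf`. -/
noncomputable def sigmaInf (n : ℕ) : ℕ := sSup (bbValues n)

theorem Machine.finite (n : ℕ) : Finite (Machine n) := by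
  have hA : Finite (Action n) :=
    Finite.of_injective (fun a : Action n => (a.next, a.write, a.move)) (by
      rintro ⟨a, b, c⟩ ⟨a', b', c'⟩ h
      simpa using h)
  exact Finite.of_injective (fun M : Machine n => (M.start, M.prog)) (by
      rintro ⟨a, b⟩ ⟨a', b'⟩ h
      simpa using h)

theorem Machine.Computes.unique {n : ℕ} {M : Machine n} {f g : Tape →. Tape}
    (hf : M.Computes f) (hg : M.Computes g) : f = g := by
  funext x
  exact Part.ext fun y => (hf x y).trans (hg x y).symm

theorem bbValues_finite (n : ℕ) : (bbValues n).Finite := by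
  have := Machine.finite
  have hS : (⋃ m : Fin (n + 1), ⋃ M : Machine m,
      {k | ∃ f, M.Computes f ∧ k ∈ star f 0}).Finite := by
    refine Set.finite_iUnion fun m => Set.finite_iUnion fun M => Set.Subsingleton.finite ?_
    rintro a ⟨f, hf, ha⟩ b ⟨g, hg, hb⟩
    obtain rfl := hf.unique hg
    exact Part.mem_unique ha hb
  refine hS.subset ?_
  rintro k ⟨f, ⟨-, -, m, hm, M, hM⟩, hk⟩
  simp only [Set.mem_iUnion]
  exact ⟨⟨m, by omega⟩, M, f, hM, hk⟩

theorem Machine.HaltsWith.unique {n : ℕ} {M : Machine n} {x y z : Tape}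
    (hy : M.HaltsWith x y) (hz : M.HaltsWith x z) : y = z := by
  obtain ⟨o, h1, h2, rfl⟩ := hy
  obtain ⟨p, h3, h4, rfl⟩ := hz
  rcases lt_trichotomy o p with h | rfl | h
  · exact absurd h2 (h3 o h)
  · rfl
  · exact absurd h4 (h1 p h)

/-- Every machine computes exactly one partial function. -/
theorem Machine.exists_computes {n : ℕ} (M : Machine n) : ∃ f, M.Computes f := by
  refine ⟨fun x => ⟨∃ y, M.HaltsWith x y, fun h => Classical.choose h⟩, fun x y => ?_⟩
  constructor
  · rintro ⟨h, rfl⟩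
    exact Classical.choose_spec h
  · intro h
    have hd : ∃ y, M.HaltsWith x y := ⟨y, h⟩
    exact ⟨hd, (Classical.choose_spec hd).unique h⟩

theorem bbValues_nonempty {n : ℕ} (hn : 1 ≤ n) : (bbValues n).Nonempty := by
  let M : Machine 1 := ⟨0, fun _ _ => ⟨State.halt, fun _ => false, Move.right⟩⟩
  obtain ⟨f, hf⟩ := M.exists_computes
  have h0 : M.run (unary 0) 0 = M.init (unary 0) := Ordinal.limitRecOn_zero ..
  have h1 : M.run (unary 0) 1 = M.step (M.init (unary 0)) := by
    have := Ordinal.limitRecOn_add_one (motive := fun _ => Config 1) 0 (M.init (unary 0))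
      (fun _ c => M.step c) (fun l _ hist => limitConfig l hist)
    rw [← h0]
    simpa [Machine.run] using this
  have hh : M.HaltsWith (unary 0) (unary 0) := by
    refine ⟨1, fun a ha => ?_, ?_, ?_⟩
    · obtain rfl : a = 0 := by simpa using ha
      rw [h0]
      simp [Machine.init]
    · rw [h1]
      simp [Machine.step, Machine.init, Machine.action, M]
    · rw [h1]
      funext i
      simp [Machine.step, Machine.init, Machine.action, M, unary, Function.update_apply]
  have hk : 0 ∈ star f 0 := (mem_star_iff f 0 0).2 ((hf _ _).2 hh)
  exact ⟨0, f, ⟨⟨1, M, hf⟩, Part.dom_iff_mem.2 ⟨0, hk⟩, 1, hn, M, hf⟩, hk⟩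

/-- For `n ≥ 1` the number `sigmaInf n` is the maximum of the values that it ranges over. -/
theorem isGreatest_sigmaInf {n : ℕ} (hn : 1 ≤ n) : IsGreatest (bbValues n) (sigmaInf n) :=
  ⟨Nat.sSup_mem (bbValues_nonempty hn) (bbValues_finite n).bddAbove,
    fun _ hk => le_csSup (bbValues_finite n).bddAbove hk⟩

end InfTime

/-! Let `M` have `m` states and compute `f`. For each large `n` there is a machine with at most `n`
states that, on blank tapes, writes `n` ones, runs `M` on them and adds a one to the result; hence
`sigmaInf n` is at least one more than the value of `star f` at `n`. Spending one state per written
one would leave no states for `M`. Instead about `n / 2` states write two blocks at once, one on the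
input tape and one on the scratch tape, and a fixed number of control states joins them
(`busyMachine_reaches_start`). The extra phases before and after `M` take finitely many steps, and a
finite delay does not affect limsups, so the run of `M` is reproduced through all limit stages
(`Machine.run_add_eq_mapState`, `Machine.haltsWith_of_simulates`). -/

namespace InfTime

/-! ### Runs of machines -/

section Run

variable {n : ℕ} (M : Machine n) (x : Tape)

theorem Machine.run_zero : M.run x 0 = M.init x := Ordinal.limitRecOn_zero ..

theorem Machine.run_add_one (a : Ordinal.{0}) : M.run x (a + 1) = M.step (M.run x a) :=
  Ordinal.limitRecOn_add_one ..

theorem Machine.run_limit {l : Ordinal.{0}} (hl : Order.IsSuccLimit l) :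
    M.run x l = limitConfig l (fun a _ => M.run x a) :=
  Ordinal.limitRecOn_limit _ _ _ _ hl

theorem Machine.run_add_nat (a : Ordinal.{0}) (t : ℕ) :
    M.run x (a + t) = M.step^[t] (M.run x a) := by
  induction t with
  | zero => simp
  | succ t ih =>
    rw [Nat.cast_succ, ← add_assoc, M.run_add_one, ih, Function.iterate_succ_apply']

variable {M} in
theorem Machine.step_of_halt {c : Config n} (h : c.state = State.halt) : M.step c = c := by
  simp [Machine.step, h]

variable {M} in
theorem Machine.iterate_step_of_halt {c : Config n} (h : c.state = State.halt) (t : ℕ) :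
    M.step^[t] c = c :=
  Function.iterate_fixed (Machine.step_of_halt h) t

variable {M} in
/-- If an iterate of the step function is halting, all later iterates agree with it. -/
theorem Machine.iterate_step_eq_of_halt {c : Config n} {i t : ℕ} (hit : i ≤ t)
    (h : (M.step^[i] c).state = State.halt) : M.step^[t] c = M.step^[i] c := by
  obtain ⟨d, rfl⟩ := Nat.exists_eq_add_of_le' hit
  rw [Function.iterate_add_apply, Machine.iterate_step_of_halt h]

/-- `M` gets from `c` to `d` in finitely many steps. -/
def Machine.Reaches (c d : Config n) : Prop := ∃ t : ℕ, M.step^[t] c = d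

variable {M}

theorem Machine.Reaches.refl (c : Config n) : M.Reaches c c := ⟨0, rfl⟩

theorem Machine.Reaches.trans {c d e : Config n} (h : M.Reaches c d) (h' : M.Reaches d e) :
    M.Reaches c e := by
  obtain ⟨s, rfl⟩ := h
  obtain ⟨t, rfl⟩ := h'
  exact ⟨t + s, Function.iterate_add_apply ..⟩

theorem Machine.Reaches.head {c d e : Config n} (h : M.step c = d) (h' : M.Reaches d e) :
    M.Reaches c e :=
  Machine.Reaches.trans ⟨1, h⟩ h'

end Run

/-! ### Simulation of a machine by another one -/

/-- Renaming of the states in a configuration. -/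
def Config.mapState {m n : ℕ} (φ : State m → State n) (c : Config m) : Config n :=
  ⟨φ c.state, c.head, c.tape⟩

/-- If `N` simulates the steps of `M` from the stage `T` on, it also simulates the limit stages,
up to the first stage at which `M` halts. -/
theorem Machine.run_add_eq_mapState {m n : ℕ} {M : Machine m} {N : Machine n}
    {φ : State m → State n} (hlim : φ State.limit = State.limit)
    (hstep : ∀ c : Config m, c.state ≠ State.halt →
      N.step (c.mapState φ) = (M.step c).mapState φ)
    {x y : Tape} {T : Ordinal.{0}} (hT : N.run y T = (M.init x).mapState φ)
    {o : Ordinal.{0}} (ho : ∀ a < o, (M.run x a).state ≠ State.halt) :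
    ∀ a ≤ o, N.run y (T + a) = (M.run x a).mapState φ := by
  intro a
  induction a using Ordinal.limitRecOn with
  | zero => intro _; rw [add_zero, hT, M.run_zero]
  | add_one a ih =>
    intro hao
    have hlt : a < o := lt_of_lt_of_le (lt_add_one a) hao
    rw [← add_assoc, N.run_add_one, ih hlt.le, M.run_add_one, hstep _ (ho a hlt)]
  | limit l hl ih =>
    intro hlo
    have hTl : Order.IsSuccLimit (T + l) := Ordinal.isSuccLimit_add T hl
    rw [N.run_limit _ hTl, M.run_limit _ hl]
    simp only [limitConfig, Config.mapState, hlim, Config.mk.injEq, true_and]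
    funext t i
    refine decide_eq_decide.2 ⟨fun h a ha => ?_, fun h a ha => ?_⟩
    · obtain ⟨b, hb, hab, hbt⟩ := h (T + a) (by simpa using ha)
      obtain ⟨d, rfl⟩ := exists_add_of_le ((le_self_add (a := T) (b := a)).trans hab)
      have hd : d < l := by simpa using hb
      rw [ih d hd (hd.le.trans hlo)] at hbt
      exact ⟨d, hd, by simpa using hab, hbt⟩
    -- The stage `a` may precede `T`; then the truncated difference is 0, and any cofinal witness
    -- from the run of `M` will do.
    · have hal : a - T < l := by
        rcases le_total T a with hTa | haT
        · rwa [← add_lt_add_iff_left T, Ordinal.add_sub_cancel_of_le hTa]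
        · rw [Ordinal.sub_eq_zero_iff_le.2 haT]
          exact hl.bot_lt
      obtain ⟨b, hb, hab, hbt⟩ := h _ hal
      refine ⟨T + b, by simpa using hb, ?_, ?_⟩
      · exact (Ordinal.le_add_sub a T).trans (by gcongr)
      · rw [ih b hb (hb.le.trans hlo)]
        exact hbt

/-- A machine `N` that reaches the start of a computation of `M`, simulates `M` with its halt state
renamed, and then comes to a halt, halts with the output on its tape. -/
theorem Machine.haltsWith_of_simulates {m n : ℕ} {M : Machine m} {N : Machine n}
    {φ : State m → State n} (hlim : φ State.limit = State.limit)
    (hhalt : ∀ q, φ q ≠ State.halt)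
    (hstep : ∀ c : Config m, c.state ≠ State.halt →
      N.step (c.mapState φ) = (M.step c).mapState φ)
    {x y u v : Tape} (hinit : N.Reaches (N.init y) ((M.init x).mapState φ))
    (hM : M.HaltsWith x u)
    (hend : ∀ c : Config m, c.state = State.halt → c.tape TapeName.output = u →
      ∃ d, N.Reaches (c.mapState φ) d ∧ d.state = State.halt ∧ d.tape TapeName.output = v) :
    N.HaltsWith y v := by
  classical
  obtain ⟨T, hT⟩ := hinit
  obtain ⟨o, ho, hoh, hou⟩ := hM
  have hrun (t : ℕ) : N.run y t = N.step^[t] (N.init y) := by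
    simpa [N.run_zero] using N.run_add_nat y 0 t
  have hsim := Machine.run_add_eq_mapState hlim hstep ((hrun T).trans hT) ho
  obtain ⟨d, ⟨t, ht⟩, hd, hdv⟩ := hend _ hoh hou
  rw [← hsim o le_rfl] at ht
  -- `t` need not be the first halting time, which `HaltsWith` demands. Halting configurations are
  -- fixed by `step`, so the first one is already `d`.
  have hex : ∃ i, (N.step^[i] (N.run y (T + o))).state = State.halt := ⟨t, by rw [ht, hd]⟩
  have hfin : N.step^[Nat.find hex] (N.run y (T + o)) = d := by
    rw [← ht]
    exact (Machine.iterate_step_eq_of_halt (Nat.find_min' hex (by rw [ht, hd]))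
      (Nat.find_spec hex)).symm
  refine ⟨T + o + (Nat.find hex : ℕ), fun a ha => ?_, ?_, ?_⟩
  · rcases lt_or_ge a T with haT | haT
    · obtain ⟨k, rfl⟩ := Ordinal.lt_omega0.1 (haT.trans (Ordinal.natCast_lt_omega0 T))
      intro hk
      rw [hrun] at hk
      have hkT : k ≤ T := by exact_mod_cast haT.le
      have := Machine.iterate_step_eq_of_halt hkT hk
      -- An early halt would persist up to `T`, where the state is in the range of `φ`.
      rw [hT] at this
      rw [← this] at hk
      exact hhalt _ hk
    · obtain ⟨a, rfl⟩ := exists_add_of_le haT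
      rcases le_or_gt a o with hao | hao
      · rw [hsim a hao]
        exact hhalt _
      · obtain ⟨i, rfl⟩ := exists_add_of_le hao.le
        rw [← add_assoc, add_lt_add_iff_left] at ha
        obtain ⟨k, rfl⟩ := Ordinal.lt_omega0.1 (ha.trans (Ordinal.natCast_lt_omega0 _))
        rw [← add_assoc, N.run_add_nat]
        exact Nat.find_min hex (by exact_mod_cast ha)
  · rw [N.run_add_nat, hfin, hd]
  · rw [N.run_add_nat, hfin, hdv]

/-! ### Unary codes and triples of tapes -/

theorem update_unary_true (n : ℕ) : Function.update (unary n) n true = unary (n + 1) := by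
  funext i
  rcases lt_trichotomy i n with h | rfl | h
  · simp [Function.update_of_ne h.ne, unary, h, h.trans (Nat.lt_succ_self n)]
  · simp [unary]
  · simp [Function.update_of_ne h.ne', unary, h.not_gt, Nat.not_lt.2 (Nat.succ_le_of_lt h)]

theorem update_unary_false (n : ℕ) : Function.update (unary (n + 1)) n false = unary n := by
  rw [← update_unary_true, Function.update_idem, Function.update_eq_self_iff]
  simp [unary]

/-- Writing the `p`-th bit of the code of `k` on the code of `min p k`. -/
theorem update_unary_min (p k : ℕ) :
    Function.update (unary (min p k)) p (decide (p < k)) = unary (min (p + 1) k) := by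
  rcases lt_or_ge p k with h | h
  · rw [min_eq_left h.le, min_eq_left (Nat.succ_le_of_lt h), decide_eq_true h, update_unary_true]
  · rw [min_eq_right h, min_eq_right (h.trans (Nat.le_succ p)), Function.update_eq_self_iff]
    simp [unary]

/-- The family with the given entries for the three tapes. -/
def tapes {α : Type} (x y z : α) : TapeName → α
  | TapeName.input => x
  | TapeName.output => y
  | TapeName.scratch => z

theorem tapes_eta {α : Type} (w : TapeName → α) :
    tapes (w TapeName.input) (w TapeName.output) (w TapeName.scratch) = w := by
  funext t
  cases t <;> rfl

theorem Machine.init_eq {n : ℕ} (M : Machine n) (x : Tape) :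
    M.init x = ⟨State.work M.start, 0, tapes x (unary 0) (unary 0)⟩ := by
  simp only [Machine.init, Config.mk.injEq, true_and]
  funext t
  cases t <;> simp [tapes, funext_iff, unary]

theorem Machine.step_tapes {n : ℕ} {N : Machine n} {i : Fin n} {p : ℕ} {x y z : Tape}
    {a : Action n} (h : N.prog (State.work i) (tapes (x p) (y p) (z p)) = a) :
    N.step ⟨State.work i, p, tapes x y z⟩ =
      ⟨a.next, a.move.apply p, tapes (Function.update x p (a.write TapeName.input))
        (Function.update y p (a.write TapeName.output))
        (Function.update z p (a.write TapeName.scratch))⟩ := by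
  have hr : (fun t => tapes x y z t p) = tapes (x p) (y p) (z p) := by
    funext t
    cases t <;> rfl
  simp only [Machine.step, Machine.action, hr, h, reduceCtorEq, if_false, Config.mk.injEq, true_and]
  funext t
  cases t <;> rfl

/-! ### The machine that computes on a self-made unary input and adds one -/

/-- The control states of the machine `busyMachine`. -/
inductive Control where
  | seekLeft : Control
  | seekRight : Control
  | toEnd : Control
  | toOne : Control
  | append : Control

/-- The control states are in bijection with `Fin 5`. -/
def controlEquiv : Control ≃ Fin 5 where
  toFun
    | .seekLeft => 0
    | .seekRight => 1
    | .toEnd => 2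
    | .toOne => 3
    | .append => 4
  invFun := ![.seekLeft, .seekRight, .toEnd, .toOne, .append]
  left_inv := by rintro (_ | _ | _ | _ | _) <;> rfl
  right_inv := by intro i; fin_cases i <;> rfl

/-- The numbering of the states of the machine `busyMachine`: those of the simulated machine,
those that write the initial block of ones, and the control states. -/
def busyEquiv (m b : ℕ) : Fin m ⊕ Fin b ⊕ Control ≃ Fin (m + (b + 5)) :=
  ((Equiv.refl _).sumCongr (((Equiv.refl _).sumCongr controlEquiv).trans finSumFinEquiv)).trans
    finSumFinEquiv

section Busy

variable {m b : ℕ}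

/-- The state of `busyMachine` that corresponds to a control state. -/
def ctl (m b : ℕ) (c : Control) : State (m + (b + 5)) :=
  State.work (busyEquiv m b (Sum.inr (Sum.inr c)))

/-- The state of `busyMachine` that corresponds to a state of the simulated machine. -/
def simState (m b : ℕ) : State m → State (m + (b + 5))
  -- Where `M` would stop, the appending phase takes over.
  | State.halt => ctl m b Control.toEnd
  | State.limit => State.limit
  | State.work i => State.work (busyEquiv m b (Sum.inl i))

/-- The action of `busyMachine` that corresponds to an action of the simulated machine. -/
def simAction (m b : ℕ) (a : Action m) : Action (m + (b + 5)) :=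
  ⟨simState m b a.next, a.write, a.move⟩

/-- The next state after the `i`-th state of the initial block. -/
def blockNext (m b i : ℕ) : State (m + (b + 5)) :=
  if h : i < b then State.work (busyEquiv m b (Sum.inr (Sum.inl ⟨i, h⟩)))
  else ctl m b Control.seekLeft

/-- The actions in the control states: `seekLeft` and `seekRight` carry the ones from the scratch
tape to the end of the block on the input tape and finally start `M`; the other states append a one
to a nonempty block on the output tape. -/
def controlAction (M : Machine m) (b : ℕ) (r : TapeName → Bool) :
    Control → Action (m + (b + 5))
  | .seekLeft =>
    if r .scratch then
      ⟨ctl m b .seekRight, tapes (r .input) (r .output) false, .right⟩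
    else if r .output then
      ⟨simState m b (.work M.start), tapes (r .input) false (r .scratch), .left⟩
    else ⟨ctl m b .seekLeft, r, .left⟩
  | .seekRight =>
    if r .input then ⟨ctl m b .seekRight, r, .right⟩
    else ⟨ctl m b .seekLeft, tapes true (r .output) (r .scratch), .left⟩
  | .toEnd => if r .output then ⟨ctl m b .toEnd, r, .right⟩ else ⟨ctl m b .toOne, r, .left⟩
  | .toOne => if r .output then ⟨ctl m b .append, r, .right⟩ else ⟨ctl m b .toOne, r, .left⟩
  | .append => ⟨.halt, tapes (r .input) true (r .scratch), .right⟩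

/-- The machine that, on blank tapes, writes `b + s` ones on the input tape, runs `M` and appends
a one to the output. -/
def busyMachine (M : Machine m) (b s : ℕ) (hb : 0 < b) : Machine (m + (b + 5)) where
  start := busyEquiv m b (Sum.inr (Sum.inl ⟨0, hb⟩))
  prog
    | .halt, r => ⟨.halt, r, .right⟩
    -- The only limit state can be left to `M`, since the other phases are finite.
    | .limit, r => simAction m b (M.prog .limit r)
    | .work j, r =>
      match (busyEquiv m b).symm j with
      | .inl i => simAction m b (M.prog (.work i) r)
      | .inr (.inl i) =>
        -- The single one on the output tape marks the leftmost cell, so that `seekLeft` can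
        -- recognize it; it is erased when `M` is started.
        ⟨blockNext m b (i + 1), tapes true (decide ((i : ℕ) < 1)) (decide ((i : ℕ) < s)), .right⟩
      | .inr (.inr c) => controlAction M b r c

variable (M : Machine m) {s : ℕ} (hb : 0 < b)

theorem busyMachine_prog_block {i : ℕ} (hi : i < b) (r : TapeName → Bool) :
    (busyMachine M b s hb).prog (State.work (busyEquiv m b (Sum.inr (Sum.inl ⟨i, hi⟩)))) r =
      ⟨blockNext m b (i + 1), tapes true (decide (i < 1)) (decide (i < s)), .right⟩ := by
  simp [busyMachine]

theorem busyMachine_prog_ctl (c : Control) (r : TapeName → Bool) :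
    (busyMachine M b s hb).prog (State.work (busyEquiv m b (Sum.inr (Sum.inr c)))) r =
      controlAction M b r c := by
  simp [busyMachine]

theorem busyMachine_prog_simState {q : State m} (hq : q ≠ State.halt) (r : TapeName → Bool) :
    (busyMachine M b s hb).prog (simState m b q) r = simAction m b (M.prog q r) := by
  cases q with
  | halt => exact absurd rfl hq
  | limit => rfl
  | work i => simp [busyMachine, simState]

theorem simState_ne_halt (q : State m) : simState m b q ≠ State.halt := by
  cases q <;> simp [simState, ctl]

theorem busyMachine_step_mapState {c : Config m} (hc : c.state ≠ State.halt) :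
    (busyMachine M b s hb).step (c.mapState (simState m b)) =
      (M.step c).mapState (simState m b) := by
  simp only [Machine.step, Machine.action, Config.mapState, simState_ne_halt, hc, if_false,
    busyMachine_prog_simState M hb hc]
  rfl

theorem busyMachine_step_ctl {c : Control} {p : ℕ} {x y z : Tape} {q : State (m + (b + 5))}
    {u v w : Bool} {d : Move}
    (h : controlAction M b (tapes (x p) (y p) (z p)) c = ⟨q, tapes u v w, d⟩) :
    (busyMachine M b s hb).step ⟨ctl m b c, p, tapes x y z⟩ =
      ⟨q, d.apply p, tapes (Function.update x p u) (Function.update y p v)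
        (Function.update z p w)⟩ :=
  Machine.step_tapes ((busyMachine_prog_ctl M hb c _).trans h)

theorem busyMachine_step_ctl_keep {c : Control} {p : ℕ} {x y z : Tape} {q : State (m + (b + 5))}
    {d : Move} (h : controlAction M b (tapes (x p) (y p) (z p)) c =
      ⟨q, tapes (x p) (y p) (z p), d⟩) :
    (busyMachine M b s hb).step ⟨ctl m b c, p, tapes x y z⟩ = ⟨q, d.apply p, tapes x y z⟩ := by
  rw [busyMachine_step_ctl M hb h]
  simp only [Function.update_eq_self]

/-- A control state that scans to the left. -/
theorem busyMachine_reaches_left {c : Control} {x y z : Tape} {p e : ℕ} (hpe : p ≤ e)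
    (h : ∀ q, p < q → q ≤ e → controlAction M b (tapes (x q) (y q) (z q)) c =
      ⟨ctl m b c, tapes (x q) (y q) (z q), .left⟩) :
    (busyMachine M b s hb).Reaches ⟨ctl m b c, e, tapes x y z⟩ ⟨ctl m b c, p, tapes x y z⟩ := by
  induction e, hpe using Nat.le_induction with
  | base => exact .refl _
  | succ e hpe ih =>
    exact .head (busyMachine_step_ctl_keep M hb (h (e + 1) (by omega) le_rfl))
      (ih fun q h1 h2 => h q h1 (by omega))

/-- A control state that scans to the right. -/
theorem busyMachine_reaches_right {c : Control} {x y z : Tape} {p e : ℕ} (hpe : p ≤ e)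
    (h : ∀ q, p ≤ q → q < e → controlAction M b (tapes (x q) (y q) (z q)) c =
      ⟨ctl m b c, tapes (x q) (y q) (z q), .right⟩) :
    (busyMachine M b s hb).Reaches ⟨ctl m b c, p, tapes x y z⟩ ⟨ctl m b c, e, tapes x y z⟩ := by
  induction e, hpe using Nat.le_induction with
  | base => exact .refl _
  | succ e hpe ih =>
    exact (ih fun q h1 h2 => h q h1 (by omega)).trans
      (.head (busyMachine_step_ctl_keep M hb (h e hpe (by omega))) (.refl _))

/-- The initial block of ones is written. -/
theorem busyMachine_reaches_block (i : ℕ) (hi : i ≤ b) :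
    (busyMachine M b s hb).Reaches ((busyMachine M b s hb).init (unary 0))
      ⟨blockNext m b i, i, tapes (unary i) (unary (min i 1)) (unary (min i s))⟩ := by
  induction i with
  | zero =>
    rw [Machine.init_eq]
    simpa [blockNext, hb, busyMachine] using Machine.Reaches.refl _
  | succ i ih =>
    refine (ih (by omega)).trans (.head (d := _) ?_ (.refl _))
    rw [blockNext, dif_pos (Nat.lt_of_succ_le hi),
      Machine.step_tapes (busyMachine_prog_block M hb (Nat.lt_of_succ_le hi) _)]
    simp only [tapes, update_unary_true, update_unary_min, Move.apply]

/-- The ones on the scratch tape are carried to the end of the block on the input tape, then `M` is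
started. -/
theorem busyMachine_reaches_start (k n p : ℕ) (hkn : k ≤ n) (hkp : k ≤ p + 1) :
    (busyMachine M b s hb).Reaches
      ⟨ctl m b .seekLeft, p, tapes (unary n) (unary 1) (unary k)⟩
      ((M.init (unary (n + k))).mapState (simState m b)) := by
  induction k generalizing n p with
  | zero =>
    refine (busyMachine_reaches_left M hb (Nat.zero_le p) fun q h1 _ => ?_).trans
      (.head (d := _) (busyMachine_step_ctl M hb (q := simState m b (.work M.start)) (u := unary n 0)
        (v := false) (w := unary 0 0) (d := .left) ?_) ?_)
    · simp [controlAction, tapes, unary, Nat.pos_iff_ne_zero.1 h1]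
    · simp [controlAction, tapes, unary]
    · rw [Machine.init_eq, update_unary_false, Function.update_eq_self, Function.update_eq_self]
      exact .refl _
  | succ k ih =>
    -- The last one on the scratch tape is the one removed, so what remains is again a unary code.
    refine (busyMachine_reaches_left M hb (p := k) (by omega) fun q h1 _ => ?_).trans
      (.head (d := _) (busyMachine_step_ctl M hb (q := ctl m b .seekRight) (u := unary n k)
        (v := unary 1 k) (w := false) (d := .right) ?_) ?_)
    · have h2 : ¬ q < k + 1 := by omega
      have h3 : ¬ q < 1 := by omega
      simp [controlAction, tapes, unary, h2, h3]
    · simp [controlAction, tapes, unary]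
    rw [update_unary_false, Function.update_eq_self, Function.update_eq_self]
    refine (busyMachine_reaches_right M hb (p := k + 1) (e := n) hkn fun q _ h2 => ?_).trans
      (.head (d := _) (busyMachine_step_ctl M hb (q := ctl m b .seekLeft) (u := true)
        (v := unary 1 n) (w := unary k n) (d := .left) ?_) ?_)
    · simp [controlAction, tapes, unary, h2]
    · simp [controlAction, tapes, unary]
    rw [update_unary_true, Function.update_eq_self, Function.update_eq_self,
      show n + (k + 1) = n + 1 + k by omega]
    exact ih (n + 1) (n - 1) (by omega) (by omega)

/-- A one is appended to a nonempty block on the output tape. -/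
theorem busyMachine_reaches_halt (k p : ℕ) (hk : 0 < k) (x z : Tape) :
    (busyMachine M b s hb).Reaches ⟨ctl m b .toEnd, p, tapes x (unary k) z⟩
      ⟨State.halt, k + 1, tapes x (unary (k + 1)) z⟩ := by
  -- `M` may halt with its head on either side of the end of the block. The scan to the right stops
  -- at `max p k`, and the scan back then finds the last one, at `k - 1`.
  refine (busyMachine_reaches_right M hb (le_max_left p k) fun q h1 h2 => ?_).trans
    (.head (busyMachine_step_ctl_keep M hb (q := ctl m b .toOne) (d := .left) ?_)
    ((busyMachine_reaches_left M hb (p := k - 1) ?_ fun q h1 h2 => ?_).trans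
    (.head (busyMachine_step_ctl_keep M hb (q := ctl m b .append) (d := .right) ?_)
    (.head (d := _) (busyMachine_step_ctl M hb (q := .halt) (u := x k)
        (v := true) (w := z k) (d := .right) ?_) ?_))))
  · have : q < k := by omega
    simp [controlAction, tapes, unary, this]
  · simp [controlAction, tapes, unary]
  · simp only [Move.apply]; omega
  · have : ¬ q < k := by omega
    simp [controlAction, tapes, unary, this]
  · simp [controlAction, tapes, unary, hk]
  · simp [controlAction, tapes, Nat.sub_add_cancel hk, Move.apply]
  · have hk' : Move.right.apply (k - 1) = k := Nat.sub_add_cancel hk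
    rw [hk', update_unary_true, Function.update_eq_self, Function.update_eq_self]
    exact .refl _

theorem busyMachine_haltsWith {n k : ℕ} (hs : s ≤ b) (hn : b + s = n) (hk : 0 < k)
    (h : M.HaltsWith (unary n) (unary k)) :
    (busyMachine M b s hb).HaltsWith (unary 0) (unary (k + 1)) := by
  refine Machine.haltsWith_of_simulates (φ := simState m b) rfl simState_ne_halt
    (fun c hc => busyMachine_step_mapState M hb hc) ?_ h ?_
  · subst hn
    refine (busyMachine_reaches_block M hb b le_rfl).trans ?_
    rw [blockNext, dif_neg (lt_irrefl b), min_eq_right (Nat.succ_le_of_lt hb), min_eq_right hs]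
    exact busyMachine_reaches_start M hb s b b hs (by omega)
  · rintro ⟨q, p, w⟩ hq hw
    obtain rfl : q = State.halt := hq
    have hw' : w TapeName.output = unary k := hw
    rw [Config.mapState, ← tapes_eta w, hw']
    exact ⟨_, busyMachine_reaches_halt M hb k p hk _ _, rfl, rfl⟩

end Busy

/-! ### The busy beaver function -/

theorem le_sigmaInf {l n k : ℕ} (N : Machine l) (hl : l ≤ n)
    (h : N.HaltsWith (unary 0) (unary k)) : k ≤ sigmaInf n := by
  obtain ⟨g, hg⟩ := N.exists_computes
  have hk : k ∈ star g 0 := (mem_star_iff g 0 k).2 ((hg _ _).2 h)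
  exact le_csSup (bbValues_finite n).bddAbove
    ⟨g, ⟨⟨l, N, hg⟩, Part.dom_iff_mem.2 ⟨k, hk⟩, l, hl, N, hg⟩, hk⟩

theorem sigmaInf_pos {n : ℕ} (hn : 1 ≤ n) : 0 < sigmaInf n := by
  let N : Machine 1 := ⟨0, fun _ _ => ⟨State.halt, fun _ => true, Move.right⟩⟩
  refine le_sigmaInf N hn ⟨1, fun a ha => ?_, ?_, ?_⟩
  · obtain rfl : a = 0 := by simpa using ha
    simp [N.run_zero, Machine.init]
  all_goals
    rw [← zero_add (1 : Ordinal), N.run_add_one, N.run_zero]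
    simp [Machine.step, Machine.init, Machine.action, N]
  simp [← update_unary_true, funext_iff, unary, Function.update_apply]

end InfTime

theorem theorem1 (f : InfTime.Tape →. InfTime.Tape) (hf : InfTime.ITComputable f)
    (htot : ∀ n : ℕ, (InfTime.star f n).Dom) :
    ∃ N : ℕ, ∀ n : ℕ, N ≤ n → InfTime.sigmaInf n > (InfTime.star f n).get (htot n) := by
  obtain ⟨m, M, hM⟩ := hf
  -- The state count `m + (n - n / 2) + 5` is at most `n` once `n / 2` is at least `m + 5`.
  refine ⟨2 * (m + 6), fun n hn => ?_⟩
  set k := (InfTime.star f n).get (htot n)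
  have hk : M.HaltsWith (InfTime.unary n) (InfTime.unary k) :=
    (hM _ _).1 ((InfTime.mem_star_iff f n k).1 (Part.get_mem _))
  rcases Nat.eq_zero_or_pos k with h0 | hpos
  -- On an empty output block `toOne` would find no one, so the value 0 is beaten by a one-state
  -- machine instead.
  · rw [h0]
    exact InfTime.sigmaInf_pos (by omega)
  · have hb : 0 < n - n / 2 := by omega
    exact InfTime.le_sigmaInf (InfTime.busyMachine M (n - n / 2) (n / 2) hb) (by omega)
      (InfTime.busyMachine_haltsWith M hb (by omega) (by omega) hpos hk)
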